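/- **Corollary 1.4 (Borthagaray–Li–Nochetto Conjecture).** Let $s\in(0,1)$. For measurable $A,B\subseteq\mathbb R^3$ put $L_s(A,B)=\iint_{A\times B}\frac{dX\,dY}{|X-Y|^{3+s}}$ and $$\mathrm{Per}_s(E,U)=L_s(E\cap U,E^c\cap U)+L_s(E\cap U,E^c\cap U^c)+L_s(E\cap U^c,E^c\cap U).$$ A measurable set $E\subseteq\mathbb R^3$ is called $s$-minimal in an open set $\Omega\subseteq\mathbb R^3$ if for every bounded open $U\subseteq\Omega$ we have $\mathrm{Per}_s(E,U)<+\infty$ and $\mathrm{Per}_s(E,U)\le \mathrm{Per}_s(F,U)$ for all measurable $F$ with $F\setminus U=E\setminus U$. Let $\omega\subset\mathbb R^2$ be a bounded open set with a convex corner at the origin, in the sense that there are $\rho>0$, $c>0$ and $\varphi:\mathbb R\to\mathbb R$ with $\varphi(0)=0$ and $\varphi(t)\ge c|t|$ for $|t|<\rho$, such that, in suitable orthonormal coordinates centred at the origin, $\omega\cap B_\rho=\{x_2>\varphi(x_1)\}\cap B_\rho$ (a straight corner of opening less than $\pi$ is the case $\varphi(t)=c|t|$). Let $\Omega=\omega\times\mathbb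 R$, let $\psi\in C^\infty(\mathbb R^2)$ vanish in a neighbourhood of the origin, and let $E_0=\{x_3<\psi(x_1,x_2)\}$. Let $E$ be an $s$-minimal set in $\Omega$ with $E\setminus\Omega=E_0\setminus\Omega$. Then $E$ is continuous at the origin: for every $\varepsilon>0$ there is $\delta>0$ such that, with $C_\delta=\{(x,x_3)\in\mathbb R^2\times\mathbb R: |x|<\delta\}$, $$E\cap C_\delta\subseteq\{x_3\le\varepsilon\}\quad\text{and}\quad E^c\cap C_\delta\subseteq\{x_3\ge-\varepsilon\}\qquad\text{up to sets of Lebesgue measure zero.}$$ If moreover $E$ is normalized in $\Omega$ (a point of $\Omega$ having a neighbourhood in which $E$ has measure zero does not belong to $E$, and a point of $\Omega$ having a neighbourhood in which $E^c$ has measure zero belongs to $E$), then, for the same $\delta$, both inclusions hold without exception, and $\partial E\cap C_\delta\subseteq\{|x_3|\le\varepsilon\}$. -/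

import Mathlib

open MeasureTheory Metric Topology

noncomputable section

/-- The interaction `L_s(A,B) = ∬_{A×B} |x-y|^{-(d+s)} dx dy` in `ℝ^d`, with values in `[0,∞]`. -/
def interaction {d : ℕ} (s : ℝ) (A B : Set (EuclideanSpace ℝ (Fin d))) : ENNReal :=
  ∫⁻ x in A, ∫⁻ y in B, ENNReal.ofReal (‖x - y‖ ^ (-((d : ℝ) + s)))

/-- The `s`-perimeter of `E` in `U`. -/
def sPerimeter {d : ℕ} (s : ℝ) (E U : Set (EuclideanSpace ℝ (Fin d))) : ENNReal :=
  interaction s (E ∩ U) (Eᶜ ∩ U) + interaction s (E ∩ U) (Eᶜ ∩ Uᶜ)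
    + interaction s (E ∩ Uᶜ) (Eᶜ ∩ U)

/-- `s`-minimality in one (bounded) set `U`: the perimeter in `U` is finite, and it does not exceed
that of any (Lebesgue measurable) competitor which agrees with `E` outside `U`. -/
def IsSMinimalInBounded {d : ℕ} (s : ℝ) (E U : Set (EuclideanSpace ℝ (Fin d))) : Prop :=
  sPerimeter s E U < ⊤ ∧
    ∀ F : Set (EuclideanSpace ℝ (Fin d)), NullMeasurableSet F volume → E \ U = F \ U →
      sPerimeter s E U ≤ sPerimeter s F U

/-- `s`-minimality of a Lebesgue measurable set `E` in a possibly unbounded set `Ω`: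
`s`-minimality in every bounded open set contained in `Ω`. -/
def IsSMinimal {d : ℕ} (s : ℝ) (E Ω : Set (EuclideanSpace ℝ (Fin d))) : Prop :=
  NullMeasurableSet E volume ∧
    ∀ U : Set (EuclideanSpace ℝ (Fin d)), IsOpen U → Bornology.IsBounded U → U ⊆ Ω →
      IsSMinimalInBounded s E U

/-- The usual choice of representative in a Lebesgue class, at the points of `Ω`: points near which
`E` has measure zero are not in `E`, points near which `Eᶜ` has measure zero are in `E`. -/
def IsNormalizedIn {d : ℕ} (E Ω : Set (EuclideanSpace ℝ (Fin d))) : Prop :=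
  ∀ X ∈ Ω, ((∃ r > 0, volume (E ∩ ball X r) = 0) → X ∉ E) ∧
    ((∃ r > 0, volume (Eᶜ ∩ ball X r) = 0) → X ∈ E)

/-- The horizontal projection `(x₁,x₂,x₃) ↦ (x₁,x₂)`. -/
def horizontal (X : EuclideanSpace ℝ (Fin 3)) : EuclideanSpace ℝ (Fin 2) := !₂[X 0, X 1]

/-- The vertical cylinder `ω × ℝ`. -/
def verticalCylinder (ω : Set (EuclideanSpace ℝ (Fin 2))) : Set (EuclideanSpace ℝ (Fin 3)) :=
  {X | horizontal X ∈ ω}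

/-- The region `{x₃ < ψ(x₁,x₂)}` below the graph of `ψ`. -/
def subgraph (ψ : EuclideanSpace ℝ (Fin 2) → ℝ) : Set (EuclideanSpace ℝ (Fin 3)) :=
  {X | X 2 < ψ (horizontal X)}

/-- `ω` has a convex corner at the origin: in suitable orthonormal coordinates, `ω` is near the
origin the region above the graph of a function `φ` with `φ(0) = 0` and `φ(t) ≥ c|t|`, `c > 0`.
A straight corner of opening less than `π` is the case `φ(t) = c|t|`; the sides of the corner
may also be curved. -/
def HasConvexCornerAtZero (ω : Set (EuclideanSpace ℝ (Fin 2))) : Prop :=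
  ∃ (T : EuclideanSpace ℝ (Fin 2) ≃ₗᵢ[ℝ] EuclideanSpace ℝ (Fin 2)) (ρ c : ℝ) (φ : ℝ → ℝ),
    0 < ρ ∧ 0 < c ∧ φ 0 = 0 ∧ (∀ t : ℝ, |t| < ρ → c * |t| ≤ φ t) ∧
      ∀ x : EuclideanSpace ℝ (Fin 2), ‖x‖ < ρ → (T x ∈ ω ↔ φ (x 0) < x 1)

end

/-! Near the edge the exterior datum is trivial away from height zero: in a small ball about an axis
point above height `ε`, `E` has no points outside the cylinder, so it lies in a convex wedge with
the centre on its edge. The core, `IsSMinimal.exists_measure_inter_ball_eq_zero`, says that a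
minimal set is then null near the centre, in a ball whose size does not depend on the height. It is
applied to `E` above and to `Eᶜ` below.

For the core, cut from `E` its part in `{f < τ}`, where `f` is a linear function increasing into the
wedge plus a small multiple of the squared coordinate along the edge. Seen from a point `x` of the
cut, the sides `f > f x` and `f < f x` have equal kernel mass up to a bounded error
(`exists_lintegral_truncKernel_above_le`). But a box of size `τ` on the upper side lies outside the
wedge, hence in `Eᶜ`, and carries mass of order `τ^(-s)` (`le_lintegral_box_truncKernel`), which
wins for small `τ`. Integrated over the cut, the interaction of the cut with itself cancels by
symmetry, so removing a cut of positive measure would lower the perimeter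
(`measure_eq_zero_of_calibration`). No regularity of `E` enters. -/

/-- The kernel `|z|^{-(d+s)}` of the fractional perimeter (equal to `0` at `z = 0`). -/
noncomputable def fracKernel {d : ℕ} (s : ℝ) (z : EuclideanSpace ℝ (Fin d)) : ENNReal :=
  ENNReal.ofReal (‖z‖ ^ (-((d : ℝ) + s)))

/-- The kernel truncated to `|z| > η`. -/
noncomputable def truncKernel {d : ℕ} (s η : ℝ) (z : EuclideanSpace ℝ (Fin d)) : ENNReal :=
  {z : EuclideanSpace ℝ (Fin d) | η < ‖z‖}.indicator (fracKernel s) z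

/-! ### The kernel and its truncations. -/

section Kernel

variable {d : ℕ} {s : ℝ}

@[fun_prop]
lemma measurable_fracKernel : Measurable (fracKernel (d := d) s) := by
  unfold fracKernel
  fun_prop

@[fun_prop]
lemma measurable_truncKernel (η : ℝ) : Measurable (truncKernel (d := d) s η) :=
  measurable_fracKernel.indicator (measurableSet_lt measurable_const measurable_norm)

lemma fracKernel_neg (z : EuclideanSpace ℝ (Fin d)) : fracKernel s (-z) = fracKernel s z := by
  simp [fracKernel]

lemma truncKernel_neg (η : ℝ) (z : EuclideanSpace ℝ (Fin d)) :
    truncKernel s η (-z) = truncKernel s η z := by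
  simp [truncKernel, Set.indicator, fracKernel_neg]

lemma truncKernel_sub_comm (η : ℝ) (x y : EuclideanSpace ℝ (Fin d)) :
    truncKernel s η (x - y) = truncKernel s η (y - x) := by
  rw [← truncKernel_neg, neg_sub]

lemma fracKernel_zero (hs : 0 < s) : fracKernel (d := d) s 0 = 0 := by
  have : -((d : ℝ) + s) ≠ 0 := by
    have : (0 : ℝ) ≤ d := Nat.cast_nonneg d
    linarith
  rw [fracKernel, norm_zero, Real.zero_rpow this, ENNReal.ofReal_zero]

lemma truncKernel_le (η : ℝ) (z : EuclideanSpace ℝ (Fin d)) :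
    truncKernel s η z ≤ fracKernel s z :=
  Set.indicator_le_self _ _ _

lemma fracKernel_anti (hs : 0 < s) {z : EuclideanSpace ℝ (Fin d)} {r : ℝ} (hr : 0 < r)
    (hz : r ≤ ‖z‖) : fracKernel s z ≤ ENNReal.ofReal (r ^ (-((d : ℝ) + s))) := by
  have : (0 : ℝ) ≤ d := Nat.cast_nonneg d
  exact ENNReal.ofReal_le_ofReal (Real.rpow_le_rpow_of_nonpos hr hz (by linarith))

lemma truncKernel_le_const (hs : 0 < s) {η : ℝ} (hη : 0 < η) (z : EuclideanSpace ℝ (Fin d)) :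
    truncKernel s η z ≤ ENNReal.ofReal (η ^ (-((d : ℝ) + s))) :=
  Set.indicator_le' (fun _ hz => fracKernel_anti hs hη (le_of_lt hz)) (fun _ _ => zero_le) z

lemma truncKernel_antitone (z : EuclideanSpace ℝ (Fin d)) {η η' : ℝ} (h : η' ≤ η) :
    truncKernel s η z ≤ truncKernel s η' z :=
  Set.indicator_le_indicator_of_subset (fun _ hz => lt_of_le_of_lt h hz) (fun _ => zero_le) z

/-- The convention that the kernel vanishes at the origin makes this hold at `z = 0` too. -/
lemma iSup_truncKernel (hs : 0 < s) {η : ℕ → ℝ}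
    (hη0 : Filter.Tendsto η Filter.atTop (𝓝 0)) (z : EuclideanSpace ℝ (Fin d)) :
    ⨆ n, truncKernel s (η n) z = fracKernel s z := by
  refine le_antisymm (iSup_le fun n => truncKernel_le _ _) ?_
  rcases eq_or_ne z 0 with rfl | hz
  · simp [fracKernel_zero hs]
  obtain ⟨n, hn⟩ := (hη0.eventually (gt_mem_nhds (norm_pos_iff.2 hz))).exists
  refine le_iSup_of_le n ?_
  rw [truncKernel, Set.indicator_of_mem (by exact hn)]

/-! ### Interactions, minimality and calibration. -/

lemma interaction_eq (A B : Set (EuclideanSpace ℝ (Fin d))) :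
    interaction s A B = ∫⁻ x in A, ∫⁻ y in B, fracKernel s (x - y) := rfl

lemma interaction_comm (A B : Set (EuclideanSpace ℝ (Fin d))) :
    interaction s A B = interaction s B A := by
  rw [interaction_eq, lintegral_lintegral_swap, interaction_eq]
  · refine lintegral_congr fun x => lintegral_congr fun y => ?_
    rw [← fracKernel_neg, neg_sub]
  · exact Measurable.aemeasurable (by unfold Function.uncurry; fun_prop)

lemma interaction_union_right (A : Set (EuclideanSpace ℝ (Fin d)))
    {B C : Set (EuclideanSpace ℝ (Fin d))} (hBC : Disjoint B C) (hC : NullMeasurableSet C) :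
    interaction s A (B ∪ C) = interaction s A B + interaction s A C := by
  simp_rw [interaction_eq]
  rw [Measure.restrict_union₀ hBC.aedisjoint hC]
  simp_rw [lintegral_add_measure]
  exact lintegral_add_left (Measurable.lintegral_prod_right'
    (f := fun p : _ × _ => fracKernel s (p.1 - p.2)) (by fun_prop)) _

lemma interaction_empty_left (B : Set (EuclideanSpace ℝ (Fin d))) :
    interaction s ∅ B = 0 := by
  simp [interaction]

lemma sPerimeter_compl (E U : Set (EuclideanSpace ℝ (Fin d))) :
    sPerimeter s Eᶜ U = sPerimeter s E U := by
  simp only [sPerimeter, compl_compl]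
  rw [interaction_comm (Eᶜ ∩ U) (E ∩ U), interaction_comm (Eᶜ ∩ U) (E ∩ Uᶜ),
    interaction_comm (Eᶜ ∩ Uᶜ) (E ∩ U)]
  ring

/-- The perimeter is symmetric in a set and its complement; this reduces the lower bound on heights
to the upper one. -/
lemma IsSMinimal.compl {E Ω : Set (EuclideanSpace ℝ (Fin d))} (h : IsSMinimal s E Ω) :
    IsSMinimal s Eᶜ Ω := by
  refine ⟨h.1.compl, fun U hU hb hUΩ => ?_⟩
  obtain ⟨h1, h2⟩ := h.2 U hU hb hUΩ
  refine ⟨by rwa [sPerimeter_compl], fun F hF hEF => ?_⟩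
  rw [sPerimeter_compl, ← sPerimeter_compl F]
  refine h2 _ hF.compl ?_
  ext x
  have := Set.ext_iff.1 hEF x
  simp only [Set.mem_sdiff, Set.mem_compl_iff] at this ⊢
  tauto

/-- Comparison of an `s`-minimal set with the set obtained by removing its part in `U`. -/
lemma IsSMinimalInBounded.interaction_le {E U : Set (EuclideanSpace ℝ (Fin d))}
    (hE : NullMeasurableSet E) (hU : MeasurableSet U) (h : IsSMinimalInBounded s E U) :
    interaction s (E ∩ U) Eᶜ < ⊤ ∧
      interaction s (E ∩ U) Eᶜ ≤ interaction s (E ∩ U) (E \ U) := by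
  obtain ⟨h1, h2⟩ := h
  have hsplit : interaction s (E ∩ U) Eᶜ =
      interaction s (E ∩ U) (Eᶜ ∩ U) + interaction s (E ∩ U) (Eᶜ ∩ Uᶜ) := by
    rw [← interaction_union_right _ _ (hE.compl.inter hU.compl.nullMeasurableSet),
      Set.inter_union_compl]
    exact Set.disjoint_left.2 fun x hx hx' => hx'.2 hx.2
  have hper : sPerimeter s E U = interaction s (E ∩ U) Eᶜ + interaction s (E \ U) (Eᶜ ∩ U) := by
    rw [hsplit]; rfl
  have hF : sPerimeter s (E \ U) U =
      interaction s (E \ U) (Eᶜ ∩ U) + interaction s (E ∩ U) (E \ U) := by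
    have e1 : (E \ U) ∩ U = ∅ := by ext; simp
    have e2 : (E \ U) ∩ Uᶜ = E \ U := by ext; simp
    have e3 : (E \ U)ᶜ ∩ U = (Eᶜ ∩ U) ∪ (E ∩ U) := by ext; simp; tauto
    rw [sPerimeter, e1, e2, e3, interaction_empty_left, interaction_empty_left,
      interaction_union_right _ _ (hE.inter hU.nullMeasurableSet), zero_add, zero_add,
      interaction_comm (E \ U) (E ∩ U)]
    exact Set.disjoint_left.2 fun x hx hx' => hx.1 hx'.1
  -- Both perimeters contain `interaction s (E \ U) (Eᶜ ∩ U)`, which is finite and can be cancelled.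
  have hle := h2 (E \ U) (hE.diff hU.nullMeasurableSet) (by ext; simp)
  rw [hper] at h1 hle
  rw [hF, add_comm] at hle
  obtain ⟨ha, hb⟩ := ENNReal.add_lt_top.1 h1
  exact ⟨ha, (ENNReal.add_le_add_iff_left hb.ne).1 hle⟩

/-- The calibration argument: if removing `A` from `E` does not decrease the `s`-perimeter and
the level sets of `f` satisfy a strict supersolution inequality at the points of `A`,
then `A` is a null set. -/
lemma measure_eq_zero_of_calibration (hs : 0 < s)
    {A B C : Set (EuclideanSpace ℝ (Fin d))} {f : EuclideanSpace ℝ (Fin d) → ℝ}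
    (hA : NullMeasurableSet A) (hAfin : volume A < ⊤) (hf : Measurable f)
    (hfin : interaction s A C < ⊤) (hle : interaction s A C ≤ interaction s A B)
    {η₀ : ℝ} (hη₀ : 0 < η₀)
    (hcal : ∀ η, 0 < η → η < η₀ → ∀ x ∈ A,
      (∫⁻ y in B, truncKernel s η (y - x)) +
          (∫⁻ y in A ∩ {y | f x < f y}, truncKernel s η (y - x)) + 1 ≤
        (∫⁻ y in C, truncKernel s η (y - x)) +
          ∫⁻ y in A ∩ {y | f y < f x}, truncKernel s η (y - x)) :
    volume A = 0 := by
  have key : ∀ η, 0 < η → η < η₀ →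
      (∫⁻ x in A, ∫⁻ y in B, truncKernel s η (y - x)) + volume A ≤ interaction s A C := by
    intro η hη hη'
    have hmeas : ∀ D : Set (EuclideanSpace ℝ (Fin d)),
        Measurable fun x => ∫⁻ y in D, truncKernel s η (y - x) := fun D =>
      Measurable.lintegral_prod_right' (f := fun p : _ × _ => truncKernel s η (p.2 - p.1))
        (by fun_prop)
    have hind1 : ∀ x, (∫⁻ y in A ∩ {y | f x < f y}, truncKernel s η (y - x)) =
        ∫⁻ y in A, {p : EuclideanSpace ℝ (Fin d) × EuclideanSpace ℝ (Fin d) |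
          f p.1 < f p.2}.indicator (fun p => truncKernel s η (p.2 - p.1)) (x, y) := by
      intro x
      rw [Set.inter_comm, ← Measure.restrict_restrict (measurableSet_lt measurable_const hf),
        ← lintegral_indicator (measurableSet_lt measurable_const hf)]
      rfl
    have hind2 : ∀ x, (∫⁻ y in A ∩ {y | f y < f x}, truncKernel s η (y - x)) =
        ∫⁻ y in A, {p : EuclideanSpace ℝ (Fin d) × EuclideanSpace ℝ (Fin d) |
          f p.1 < f p.2}.indicator (fun p => truncKernel s η (p.2 - p.1)) (y, x) := by
      intro x
      rw [Set.inter_comm, ← Measure.restrict_restrict (measurableSet_lt hf measurable_const),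
        ← lintegral_indicator (measurableSet_lt hf measurable_const)]
      refine lintegral_congr fun y => ?_
      simp only [Set.indicator, Set.mem_ofPred_eq, truncKernel_sub_comm η x y]
    have hm : Measurable ({p : EuclideanSpace ℝ (Fin d) × EuclideanSpace ℝ (Fin d) |
          f p.1 < f p.2}.indicator (fun p => truncKernel s η (p.2 - p.1))) :=
      Measurable.indicator (by fun_prop)
        (measurableSet_lt (hf.comp measurable_fst) (hf.comp measurable_snd))
    set g := ({p : EuclideanSpace ℝ (Fin d) × EuclideanSpace ℝ (Fin d) |
          f p.1 < f p.2}.indicator (fun p => truncKernel s η (p.2 - p.1))) with hg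
    -- The two self-interaction terms of `A` are exchanged by swapping the variables, as the kernel
    -- is even.
    have hswap : ∫⁻ x in A, ∫⁻ y in A, g (y, x) = ∫⁻ x in A, ∫⁻ y in A, g (x, y) :=
      lintegral_lintegral_swap (f := fun x y => g (y, x)) (hm.comp measurable_swap).aemeasurable
    -- The truncation is there for this: it makes the self-interaction finite, so that it can be
    -- cancelled.
    have hQ : ∫⁻ x in A, ∫⁻ y in A, g (x, y) < ⊤ := by
      have hb : ∀ p, g p ≤ ENNReal.ofReal (η ^ (-((d : ℝ) + s))) := fun p =>
        Set.indicator_le' (fun _ _ => truncKernel_le_const hs hη _) (fun _ _ => zero_le) p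
      calc ∫⁻ x in A, ∫⁻ y in A, g (x, y)
          ≤ ∫⁻ x in A, ∫⁻ y in A, ENNReal.ofReal (η ^ (-((d : ℝ) + s))) :=
            lintegral_mono fun x => lintegral_mono fun y => hb _
        _ < ⊤ := by
            simp only [lintegral_const, Measure.restrict_apply_univ]
            exact ENNReal.mul_lt_top (ENNReal.mul_lt_top ENNReal.ofReal_lt_top hAfin) hAfin
    have hint : (∫⁻ x in A, ∫⁻ y in B, truncKernel s η (y - x)) +
        (∫⁻ x in A, ∫⁻ y in A, g (x, y)) + volume A ≤
        (∫⁻ x in A, ∫⁻ y in C, truncKernel s η (y - x)) +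
        ∫⁻ x in A, ∫⁻ y in A, g (x, y) := by
      have hgx : Measurable fun x => ∫⁻ y in A, g (x, y) := hm.lintegral_prod_right'
      have h1 : volume A = ∫⁻ x in A, 1 := by simp
      rw [h1]
      conv_rhs => rw [← hswap]
      rw [← lintegral_add_left (hmeas B), ← lintegral_add_right _ measurable_const,
        ← lintegral_add_left (hmeas C)]
      refine lintegral_mono_ae ?_
      refine (ae_restrict_iff'₀ hA).2 (Filter.Eventually.of_forall fun x hx => ?_)
      have := hcal η hη hη' x hx
      rw [hind1, hind2] at this
      exact this
    rw [add_right_comm] at hint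
    refine ((ENNReal.add_le_add_iff_right hQ.ne).1 hint).trans ?_
    rw [interaction_eq]
    refine lintegral_mono fun x => lintegral_mono fun y => ?_
    rw [truncKernel_sub_comm]
    exact truncKernel_le _ _
  -- The shift by 2 gives `η n < η₀` already for `n = 0`.
  set η : ℕ → ℝ := fun n => η₀ / (n + 2) with hη
  have hηanti : Antitone η := fun m n hmn => by
    simp only [hη]; gcongr
  have hη0 : Filter.Tendsto η Filter.atTop (𝓝 0) :=
    Filter.Tendsto.div_atTop tendsto_const_nhds
      (Filter.tendsto_atTop_add_const_right _ _ tendsto_natCast_atTop_atTop)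
  have hsup : interaction s A B = ⨆ n, ∫⁻ x in A, ∫⁻ y in B, truncKernel s (η n) (y - x) := by
    rw [← lintegral_iSup]
    · rw [interaction_eq]
      refine lintegral_congr fun x => ?_
      rw [← lintegral_iSup]
      · refine lintegral_congr fun y => ?_
        rw [iSup_truncKernel hs hη0, ← fracKernel_neg, neg_sub]
      · intro n; fun_prop
      · exact fun m n hmn y => truncKernel_antitone _ (hηanti hmn)
    · exact fun n => Measurable.lintegral_prod_right'
        (f := fun p : _ × _ => truncKernel s (η n) (p.2 - p.1)) (by fun_prop)
    · exact fun m n hmn x => lintegral_mono fun y => truncKernel_antitone _ (hηanti hmn)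
  have hfinal : interaction s A B + volume A ≤ interaction s A C := by
    rw [hsup, ENNReal.iSup_add]
    refine iSup_le fun n => key _ (by positivity) ?_
    simp only [hη]
    rw [div_lt_iff₀ (by positivity)]
    have : (0 : ℝ) ≤ n := Nat.cast_nonneg n
    nlinarith
  have h0 : interaction s A C + volume A ≤ interaction s A C + 0 := by
    rw [add_zero]
    exact (by gcongr : interaction s A C + volume A ≤ _).trans hfinal
  exact le_antisymm ((ENNReal.add_le_add_iff_left hfin.ne).1 h0) zero_le

end Kernel

/-! ### Kernel estimates. -/

/-- The kernel `|z|^{-(d+s)}` is integrable away from the origin. -/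
lemma lintegral_compl_ball_fracKernel_lt_top {d : ℕ} {s : ℝ} (hs : 0 < s) {r : ℝ} (hr : 0 < r) :
    ∫⁻ z in (ball (0 : EuclideanSpace ℝ (Fin d)) r)ᶜ, fracKernel s z < ⊤ := by
  have hd : (0 : ℝ) ≤ d := Nat.cast_nonneg d
  -- For `‖z‖ ≥ r` one has `1 + ‖z‖ ≤ (1 + r⁻¹) * ‖z‖`.
  have hC : ∀ z ∈ (ball (0 : EuclideanSpace ℝ (Fin d)) r)ᶜ,
      fracKernel s z ≤ ENNReal.ofReal ((1 + r⁻¹) ^ ((d : ℝ) + s)) *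
        ENNReal.ofReal ((1 + ‖z‖) ^ (-((d : ℝ) + s))) := by
    intro z hz
    have hz' : r ≤ ‖z‖ := by simpa using hz
    have hz0 : 0 < ‖z‖ := hr.trans_le hz'
    rw [← ENNReal.ofReal_mul (by positivity), fracKernel]
    refine ENNReal.ofReal_le_ofReal ?_
    have h1 : ‖z‖ ^ (-((d : ℝ) + s)) =
        (1 + r⁻¹) ^ ((d : ℝ) + s) * ((1 + r⁻¹) * ‖z‖) ^ (-((d : ℝ) + s)) := by
      rw [Real.mul_rpow (by positivity) hz0.le, ← mul_assoc, ← Real.rpow_add (by positivity)]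
      simp
    rw [h1]
    refine mul_le_mul_of_nonneg_left ?_ (by positivity)
    refine Real.rpow_le_rpow_of_nonpos (by positivity) ?_ (by linarith)
    have : 1 ≤ r⁻¹ * ‖z‖ := by
      rw [inv_mul_eq_div, le_div_iff₀ hr]; linarith
    linarith
  calc ∫⁻ z in (ball (0 : EuclideanSpace ℝ (Fin d)) r)ᶜ, fracKernel s z
      ≤ ∫⁻ z in (ball (0 : EuclideanSpace ℝ (Fin d)) r)ᶜ,
          ENNReal.ofReal ((1 + r⁻¹) ^ ((d : ℝ) + s)) *
            ENNReal.ofReal ((1 + ‖z‖) ^ (-((d : ℝ) + s))) :=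
        setLIntegral_mono' measurableSet_ball.compl hC
    _ ≤ ∫⁻ z : EuclideanSpace ℝ (Fin d), ENNReal.ofReal ((1 + r⁻¹) ^ ((d : ℝ) + s)) *
            ENNReal.ofReal ((1 + ‖z‖) ^ (-((d : ℝ) + s))) := setLIntegral_le_lintegral _ _
    _ < ⊤ := by
        rw [lintegral_const_mul' _ _ ENNReal.ofReal_ne_top]
        exact ENNReal.mul_lt_top ENNReal.ofReal_lt_top
          (finite_integral_one_add_norm (by simpa using hs))

/-- In the plane the radial density contributes one power of the radius, leaving `y ^ (-s)` with `s
< 1`. -/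
lemma lintegral_ball_norm_rpow_lt_top {s : ℝ} (hs1 : s < 1) (r : ℝ) :
    ∫⁻ w in ball (0 : Fin 2 → ℝ) r, ENNReal.ofReal (‖w‖ ^ (-(1 + s))) < ⊤ := by
  have h : IntegrableOn (fun w : Fin 2 → ℝ => ‖w‖ ^ (-(1 + s))) (ball 0 r) := by
    rw [integrableOn_fun_norm_addHaar volume (f := fun y => y ^ (-(1 + s)))]
    have : IntegrableOn (fun y : ℝ => y ^ (-s)) (Set.Ioo 0 r) :=
      (intervalIntegral.intervalIntegrable_rpow' (a := 0) (b := r) (by linarith)).1.mono_set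
        Set.Ioo_subset_Ioc_self
    refine this.congr_fun (fun y hy => ?_) measurableSet_Ioo
    have hfr : Module.finrank ℝ (Fin 2 → ℝ) - 1 = 1 := by simp
    simp only [smul_eq_mul, hfr, pow_one]
    nth_rw 2 [← Real.rpow_one y]
    rw [← Real.rpow_add hy.1]
    congr 1
    ring
  exact h.setLIntegral_lt_top

/-- The kernel `|z|^{-(3+s)}` is integrable, uniformly in `m`, between the two paraboloids
`z₁ = - m z₂ ± z₂²`. -/
lemma exists_lintegral_parabolic_le {s : ℝ} (hs0 : 0 < s) (hs1 : s < 1) (r : ℝ) :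
    ∃ C : ENNReal, C < ⊤ ∧ ∀ m : ℝ,
      ∫⁻ z in {z : EuclideanSpace ℝ (Fin 3) | |z 1 + m * z 2| ≤ z 2 ^ 2 ∧ ‖z‖ < r},
        fracKernel s z ≤ C := by
  -- Over `w = (z 0, z 2)` the admissible `z 1` fill an interval of length `2 * z 2 ^ 2 ≤ 2 * ‖w‖ ^
  -- 2`, on which the kernel is at most `‖w‖ ^ (-(3 + s))`. The slope `m` only translates the
  -- interval.
  refine ⟨∫⁻ w in ball (0 : Fin 2 → ℝ) r, 2 * ENNReal.ofReal (‖w‖ ^ (-(1 + s))), ?_, fun m => ?_⟩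
  · rw [lintegral_const_mul' _ _ (by simp)]
    exact ENNReal.mul_lt_top (by simp) (lintegral_ball_norm_rpow_lt_top hs1 r)
  let g : ℝ × (Fin 2 → ℝ) → ENNReal := fun p =>
    {p : ℝ × (Fin 2 → ℝ) | |p.1 + m * p.2 1| ≤ p.2 1 ^ 2 ∧ ‖p.2‖ < r}.indicator
      (fun p => ENNReal.ofReal (‖p.2‖ ^ (-(3 + s)))) p
  have hSm : MeasurableSet {p : ℝ × (Fin 2 → ℝ) | |p.1 + m * p.2 1| ≤ p.2 1 ^ 2 ∧ ‖p.2‖ < r} :=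
    MeasurableSet.inter (s₁ := {p : ℝ × (Fin 2 → ℝ) | |p.1 + m * p.2 1| ≤ p.2 1 ^ 2})
      (s₂ := {p : ℝ × (Fin 2 → ℝ) | ‖p.2‖ < r})
      (measurableSet_le (by fun_prop) (by fun_prop)) (measurableSet_lt (by fun_prop) (by fun_prop))
  have hg : Measurable g := Measurable.indicator (by fun_prop) hSm
  let Φ : EuclideanSpace ℝ (Fin 3) → ℝ × (Fin 2 → ℝ) := fun z =>
    MeasurableEquiv.piFinSuccAbove (fun _ => ℝ) (1 : Fin 3) (WithLp.ofLp z)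
  have hΦ : MeasurePreserving Φ volume (volume.prod volume) :=
    (volume_preserving_piFinSuccAbove (fun _ => ℝ) (1 : Fin 3)).comp
      (PiLp.volume_preserving_ofLp (Fin 3))
  have hΦ1 : ∀ z, (Φ z).1 = z 1 := fun z => rfl
  have hΦ2 : ∀ z, (Φ z).2 1 = z 2 := fun z => rfl
  have hΦ0 : ∀ z, (Φ z).2 0 = z 0 := fun z => rfl
  have hnorm : ∀ z, ‖(Φ z).2‖ ≤ ‖z‖ := by
    intro z
    refine (pi_norm_le_iff_of_nonneg (norm_nonneg _)).2 fun i => ?_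
    exact PiLp.norm_apply_le z _
  have hTm : MeasurableSet
      {z : EuclideanSpace ℝ (Fin 3) | |z 1 + m * z 2| ≤ z 2 ^ 2 ∧ ‖z‖ < r} :=
    MeasurableSet.inter (s₁ := {z : EuclideanSpace ℝ (Fin 3) | |z 1 + m * z 2| ≤ z 2 ^ 2})
      (s₂ := {z : EuclideanSpace ℝ (Fin 3) | ‖z‖ < r})
      (measurableSet_le (by fun_prop) (by fun_prop)) (measurableSet_lt (by fun_prop) (by fun_prop))
  calc ∫⁻ z in {z : EuclideanSpace ℝ (Fin 3) | |z 1 + m * z 2| ≤ z 2 ^ 2 ∧ ‖z‖ < r},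
        fracKernel s z
      ≤ ∫⁻ z in {z : EuclideanSpace ℝ (Fin 3) | |z 1 + m * z 2| ≤ z 2 ^ 2 ∧ ‖z‖ < r}, g (Φ z) := by
        refine setLIntegral_mono' hTm fun z hz => ?_
        have hmem : Φ z ∈ {p : ℝ × (Fin 2 → ℝ) | |p.1 + m * p.2 1| ≤ p.2 1 ^ 2 ∧ ‖p.2‖ < r} :=
          ⟨by simpa [hΦ1, hΦ2] using hz.1, (hnorm z).trans_lt hz.2⟩
        simp only [g]
        rw [Set.indicator_of_mem hmem]
        -- At `w = 0` the majorant is 0 by the `rpow` convention; there the parabolic constraint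
        -- forces `z = 0`.
        rcases eq_or_ne (Φ z).2 0 with h0 | h0
        · have hz2 : z 2 = 0 := by rw [← hΦ2, h0]; rfl
          have hz0 : z 0 = 0 := by rw [← hΦ0, h0]; rfl
          have hz1 : z 1 = 0 := by
            have := hz.1
            rw [hz2] at this
            simpa using this
          have : z = 0 := by
            ext i; fin_cases i <;> simp [hz0, hz1, hz2]
          rw [this, fracKernel_zero hs0]
          exact zero_le
        · rw [fracKernel]
          refine ENNReal.ofReal_le_ofReal ?_
          push_cast
          exact Real.rpow_le_rpow_of_nonpos (norm_pos_iff.2 h0) (hnorm z) (by linarith)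
    _ ≤ ∫⁻ z, g (Φ z) := setLIntegral_le_lintegral _ _
    _ = ∫⁻ p, g p ∂(volume.prod volume) := hΦ.lintegral_comp hg
    _ = ∫⁻ w, ∫⁻ a, g (a, w) := lintegral_prod_symm' _ hg
    _ ≤ ∫⁻ w, (ball (0 : Fin 2 → ℝ) r).indicator
          (fun w => 2 * ENNReal.ofReal (‖w‖ ^ (-(1 + s)))) w := by
        refine lintegral_mono fun w => ?_
        by_cases hw : ‖w‖ < r
        · rw [Set.indicator_of_mem (by simpa using hw)]
          rcases eq_or_ne w 0 with rfl | hw0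
          · have : ∀ a, g (a, 0) = 0 := fun a => by
              simp only [g]
              have : -(3 + s) ≠ 0 := by linarith
              refine Set.indicator_apply_eq_zero.2 fun _ => ?_
              rw [norm_zero, Real.zero_rpow this, ENNReal.ofReal_zero]
            simp [this]
          have hwp : 0 < ‖w‖ := norm_pos_iff.2 hw0
          have hle : ∀ a, g (a, w) ≤ (Set.Icc (-(m * w 1) - w 1 ^ 2)
              (-(m * w 1) + w 1 ^ 2)).indicator
                (fun _ => ENNReal.ofReal (‖w‖ ^ (-(3 + s)))) a := by
            intro a
            by_cases ha : |a + m * w 1| ≤ w 1 ^ 2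
            · have ha' := abs_le.1 ha
              have hI : a ∈ Set.Icc (-(m * w 1) - w 1 ^ 2) (-(m * w 1) + w 1 ^ 2) :=
                ⟨by linarith, by linarith⟩
              rw [Set.indicator_of_mem hI]
              exact Set.indicator_le_self
                {p : ℝ × (Fin 2 → ℝ) | |p.1 + m * p.2 1| ≤ p.2 1 ^ 2 ∧ ‖p.2‖ < r}
                (fun p => ENNReal.ofReal (‖p.2‖ ^ (-(3 + s)))) (a, w)
            · have : g (a, w) = 0 := Set.indicator_of_notMem (fun h => ha h.1) _
              simp [this]
          calc ∫⁻ a, g (a, w) ≤ _ := lintegral_mono hle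
            _ = ENNReal.ofReal (‖w‖ ^ (-(3 + s))) * ENNReal.ofReal (2 * w 1 ^ 2) := by
                rw [lintegral_indicator_const measurableSet_Icc, Real.volume_Icc]
                congr 2
                ring
            _ ≤ ENNReal.ofReal (‖w‖ ^ (-(3 + s))) * ENNReal.ofReal (2 * ‖w‖ ^ 2) := by
                rw [← sq_abs (w 1)]
                gcongr
                exact norm_le_pi_norm w 1
            _ = 2 * ENNReal.ofReal (‖w‖ ^ (-(1 + s))) := by
                have h2 : (2 : ENNReal) = ENNReal.ofReal 2 := by simp
                rw [h2, ← ENNReal.ofReal_mul (by positivity),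
                  ← ENNReal.ofReal_mul zero_le_two]
                congr 1
                rw [← Real.rpow_natCast ‖w‖ 2, mul_left_comm, ← Real.rpow_add hwp]
                congr 2
                push_cast
                ring
        · have : ∀ a, g (a, w) = 0 := fun a => Set.indicator_of_notMem (fun h => hw h.2) _
          simp [this]
    _ = _ := lintegral_indicator measurableSet_ball _

lemma EuclideanSpace.norm_le_abs_add_abs_add_abs (z : EuclideanSpace ℝ (Fin 3)) :
    ‖z‖ ≤ |z 0| + |z 1| + |z 2| := by
  rw [EuclideanSpace.norm_eq, Fin.sum_univ_three]
  refine Real.sqrt_le_iff.2 ⟨by positivity, ?_⟩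
  simp only [Real.norm_eq_abs]
  nlinarith [mul_nonneg (abs_nonneg (z 0)) (abs_nonneg (z 1)),
    mul_nonneg (abs_nonneg (z 0)) (abs_nonneg (z 2)),
    mul_nonneg (abs_nonneg (z 1)) (abs_nonneg (z 2))]

/-- The parts of a ball above and below a paraboloid through its centre have almost the same
kernel mass: a bounded error suffices, uniformly in the orientation, the truncation
and the curvature. -/
lemma exists_lintegral_truncKernel_above_le {s : ℝ} (hs0 : 0 < s) (hs1 : s < 1) (r : ℝ) :
    ∃ C : ENNReal, C < ⊤ ∧
      ∀ (S : EuclideanSpace ℝ (Fin 3) ≃ₗᵢ[ℝ] EuclideanSpace ℝ (Fin 3)) (η m M : ℝ),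
        0 ≤ M → M ≤ 1 →
        ∫⁻ z in {z | 0 < S z 1 + m * S z 2 + M * S z 2 ^ 2 ∧ ‖z‖ < r}, truncKernel s η z ≤
          (∫⁻ z in {z | S z 1 + m * S z 2 + M * S z 2 ^ 2 < 0 ∧ ‖z‖ < r}, truncKernel s η z)
            + C := by
  obtain ⟨C, hC, hpar⟩ := exists_lintegral_parabolic_le hs0 hs1 r
  refine ⟨C, hC, fun S η m M hM0 hM1 => ?_⟩
  -- Reflection in the origin keeps the linear part but flips the curvature: the upper side is
  -- covered by the reflected lower side and a thin region between two paraboloids.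
  have hneg : ∫⁻ z in {z | - (S z 1 + m * S z 2) + M * S z 2 ^ 2 < 0 ∧ ‖z‖ < r},
      truncKernel s η z =
      ∫⁻ z in {z | S z 1 + m * S z 2 + M * S z 2 ^ 2 < 0 ∧ ‖z‖ < r}, truncKernel s η z := by
    rw [← (Measure.measurePreserving_neg volume).setLIntegral_comp_preimage_emb
      (MeasurableEquiv.neg _).measurableEmbedding]
    simp only [truncKernel_neg]
    congr 2
    ext z
    simp only [Set.mem_preimage, Set.mem_ofPred_eq, map_neg, PiLp.neg_apply, norm_neg]
    ring_nf
  have hbad : ∫⁻ z in {z | |S z 1 + m * S z 2| ≤ M * S z 2 ^ 2 ∧ ‖z‖ < r},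
      truncKernel s η z ≤ C := by
    refine le_trans ?_ (hpar m)
    rw [← S.measurePreserving.setLIntegral_comp_preimage_emb
      S.toHomeomorph.measurableEmbedding (fracKernel s)]
    have hk : ∀ z, truncKernel s η z ≤ fracKernel s (S z) := fun z => by
      refine (truncKernel_le η z).trans_eq ?_
      simp [fracKernel]
    refine (lintegral_mono hk).trans (lintegral_mono_set fun z hz => ?_)
    refine ⟨hz.1.trans ?_, by simpa using hz.2⟩
    exact mul_le_of_le_one_left (sq_nonneg _) hM1
  rw [← hneg]
  calc ∫⁻ z in {z | 0 < S z 1 + m * S z 2 + M * S z 2 ^ 2 ∧ ‖z‖ < r}, truncKernel s η z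
      ≤ ∫⁻ z in {z | - (S z 1 + m * S z 2) + M * S z 2 ^ 2 < 0 ∧ ‖z‖ < r} ∪
          {z | |S z 1 + m * S z 2| ≤ M * S z 2 ^ 2 ∧ ‖z‖ < r}, truncKernel s η z := by
        refine lintegral_mono_set fun z hz => ?_
        rcases lt_or_ge (M * S z 2 ^ 2) (S z 1 + m * S z 2) with h | h
        · exact Or.inl ⟨by linarith, hz.2⟩
        · exact Or.inr ⟨abs_le.2 ⟨by linarith [hz.1], h⟩, hz.2⟩
    _ ≤ _ := lintegral_union_le _ _ _
    _ ≤ _ := by gcongr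

lemma setLIntegral_sub_right {d : ℕ} (x : EuclideanSpace ℝ (Fin d))
    (D : Set (EuclideanSpace ℝ (Fin d))) (g : EuclideanSpace ℝ (Fin d) → ENNReal) :
    ∫⁻ y in {y | y - x ∈ D}, g (y - x) = ∫⁻ z in D, g z :=
  (measurePreserving_sub_right volume x).setLIntegral_comp_preimage_emb
    (MeasurableEquiv.subRight x).measurableEmbedding g D

/-- Lower bound for the kernel mass of a box of size `τ` at distance comparable to `τ`. -/
lemma le_lintegral_box_truncKernel {s : ℝ} (hs0 : 0 < s) {c τ η : ℝ} (hc : 0 < c) (hτ : 0 < τ)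
    (hη : η < 2 * τ) (S : EuclideanSpace ℝ (Fin 3) ≃ₗᵢ[ℝ] EuclideanSpace ℝ (Fin 3)) :
    ENNReal.ofReal ((6 / c + 4) ^ (-(3 + s)) / c * τ ^ (-s)) ≤
      ∫⁻ z in {z | S z 0 ∈ Set.Ioo (5 * τ / c) (6 * τ / c) ∧ S z 1 ∈ Set.Ioo (2 * τ) (3 * τ) ∧
        S z 2 ∈ Set.Ioo 0 τ}, truncKernel s η z := by
  set G := {z | S z 0 ∈ Set.Ioo (5 * τ / c) (6 * τ / c) ∧ S z 1 ∈ Set.Ioo (2 * τ) (3 * τ) ∧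
    S z 2 ∈ Set.Ioo 0 τ} with hG
  let lo : Fin 3 → ℝ := ![5 * τ / c, 2 * τ, 0]
  let hi : Fin 3 → ℝ := ![6 * τ / c, 3 * τ, τ]
  have hGeq : G = S ⁻¹' (WithLp.ofLp ⁻¹' (Set.univ.pi fun i => Set.Ioo (lo i) (hi i))) := by
    ext z
    simp [hG, lo, hi, Set.mem_pi, Fin.forall_fin_succ]
  have hbox : MeasurableSet (Set.univ.pi fun i => Set.Ioo (lo i) (hi i)) :=
    MeasurableSet.univ_pi fun i => measurableSet_Ioo
  have hbox' := (PiLp.volume_preserving_ofLp (Fin 3)).measurable hbox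
  have hGm : MeasurableSet G := hGeq ▸ S.measurePreserving.measurable hbox'
  have hvol : volume G = ENNReal.ofReal (τ / c * τ * τ) := by
    rw [hGeq, S.measurePreserving.measure_preimage hbox'.nullMeasurableSet,
      (PiLp.volume_preserving_ofLp (Fin 3)).measure_preimage hbox.nullMeasurableSet,
      volume_pi_pi, Fin.prod_univ_three]
    have e0 : hi 0 - lo 0 = τ / c := by simp only [lo, hi, Matrix.cons_val]; ring
    have e1 : hi 1 - lo 1 = τ := by simp only [lo, hi, Matrix.cons_val]; ring
    have e2 : hi 2 - lo 2 = τ := by simp only [lo, hi, Matrix.cons_val]; ring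
    rw [Real.volume_Ioo, Real.volume_Ioo, Real.volume_Ioo, e0, e1, e2,
      ← ENNReal.ofReal_mul (by positivity), ← ENNReal.ofReal_mul (by positivity)]
  have hL : 0 < 6 / c + 4 := by positivity
  have hk : ∀ z ∈ G, ENNReal.ofReal (((6 / c + 4) * τ) ^ (-(3 + s))) ≤ truncKernel s η z := by
    rintro z ⟨h0, h1, h2⟩
    have e0 : |S z 0| < 6 * τ / c := abs_lt.2 ⟨by
      have : 0 < 5 * τ / c := by positivity
      have : 0 < 6 * τ / c := by positivity
      linarith [h0.1], h0.2⟩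
    have e1 : |S z 1| < 3 * τ := abs_lt.2 ⟨by linarith [h1.1], h1.2⟩
    have e2 : |S z 2| < τ := abs_lt.2 ⟨by linarith [h2.1], h2.2⟩
    -- The box stays clear of the truncation.
    have hlow : 2 * τ < ‖z‖ := by
      rw [← S.norm_map z]
      exact h1.1.trans_le ((le_abs_self _).trans (PiLp.norm_apply_le (S z) 1))
    have hup : ‖z‖ ≤ (6 / c + 4) * τ := by
      rw [← S.norm_map z]
      refine (EuclideanSpace.norm_le_abs_add_abs_add_abs _).trans ?_
      have : (6 / c + 4) * τ = 6 * τ / c + 3 * τ + τ := by ring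
      linarith
    rw [truncKernel, Set.indicator_of_mem (by exact hη.trans hlow), fracKernel]
    refine ENNReal.ofReal_le_ofReal ?_
    push_cast
    exact Real.rpow_le_rpow_of_nonpos (by linarith) hup (by linarith)
  calc ENNReal.ofReal ((6 / c + 4) ^ (-(3 + s)) / c * τ ^ (-s))
      = ENNReal.ofReal (((6 / c + 4) * τ) ^ (-(3 + s))) * volume G := by
        rw [hvol, ← ENNReal.ofReal_mul (by positivity), Real.mul_rpow hL.le hτ.le]
        congr 1
        have : τ ^ (-s) = τ ^ (-(3 + s)) * (τ * τ * τ) := by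
          have h3 : τ * τ * τ = τ ^ (3 : ℝ) := by
            rw [show (3 : ℝ) = ((3 : ℕ) : ℝ) by norm_num, Real.rpow_natCast]; ring
          rw [h3, ← Real.rpow_add hτ]
          congr 1
          ring
        rw [this]
        ring
    _ = ∫⁻ z in G, ENNReal.ofReal (((6 / c + 4) * τ) ^ (-(3 + s))) := by
        rw [setLIntegral_const]
    _ ≤ _ := setLIntegral_mono' hGm hk

/-- As `τ → 0`, `τ ^ (-s)` exceeds any constant, while the other conditions only ask that `τ` be
small. -/
lemma exists_scale {s : ℝ} (hs0 : 0 < s) {r L b : ℝ} (hr : 0 < r) (hL : 0 < L) (hb : 0 < b)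
    (D : ℝ) :
    ∃ τ : ℝ, 0 < τ ∧ 16 * τ / r ^ 2 ≤ 1 ∧ L * τ ≤ r / 4 ∧ D ≤ b * τ ^ (-s) := by
  have h1 : ∀ᶠ τ : ℝ in 𝓝[>] 0, D / b ≤ τ ^ (-s) :=
    (tendsto_rpow_neg_nhdsGT_zero (by linarith)).eventually_ge_atTop _
  have h2 : ∀ᶠ τ : ℝ in 𝓝[>] 0, τ ≤ r ^ 2 / 16 :=
    nhdsWithin_le_nhds (eventually_le_nhds (by positivity))
  have h3 : ∀ᶠ τ : ℝ in 𝓝[>] 0, τ ≤ r / 4 / L :=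
    nhdsWithin_le_nhds (eventually_le_nhds (by positivity))
  obtain ⟨τ, ⟨⟨h1, h2⟩, h3⟩, h4⟩ := ((h1.and h2).and h3 |>.and self_mem_nhdsWithin).exists
  refine ⟨τ, h4, ?_, ?_, ?_⟩
  · rw [div_le_one (by positivity)]; linarith
  · rw [le_div_iff₀ hL] at h3; linarith
  · rw [div_le_iff₀ hb] at h1; linarith

/-! ### Minimal sets in a wedge. -/

/-- If near `X₀` an `s`-minimal set `E` is contained in `Ω`, and `Ω` in a convex wedge with `X₀` on
its edge, then `E` has measure zero near `X₀`, in a neighbourhood of controlled size. -/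
lemma IsSMinimal.exists_measure_inter_ball_eq_zero {s : ℝ} (hs0 : 0 < s) (hs1 : s < 1) {r c : ℝ}
    (hr : 0 < r) (hc : 0 < c) :
    ∃ δ : ℝ, 0 < δ ∧
      ∀ (S : EuclideanSpace ℝ (Fin 3) ≃ₗᵢ[ℝ] EuclideanSpace ℝ (Fin 3))
        (X₀ : EuclideanSpace ℝ (Fin 3)) (Ω E : Set (EuclideanSpace ℝ (Fin 3))),
        IsOpen Ω → (∀ X ∈ Ω, ‖X - X₀‖ < r → c * |S (X - X₀) 0| < S (X - X₀) 1) →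
        E ∩ ball X₀ r ⊆ Ω → IsSMinimal s E Ω → volume (E ∩ ball X₀ δ) = 0 := by
  have hfar := lintegral_compl_ball_fracKernel_lt_top (d := 3) hs0 (half_pos hr)
  set Cf := ∫⁻ z in (ball (0 : EuclideanSpace ℝ (Fin 3)) (r / 2))ᶜ, fracKernel s z with hCf
  obtain ⟨Cp, hCp, hpar⟩ := exists_lintegral_truncKernel_above_le hs0 hs1 (r / 2)
  have hL : 0 < 6 / c + 4 := by positivity
  obtain ⟨τ, hτ, hM1, hLτ, hgain⟩ := exists_scale hs0 hr hL
    (b := (6 / c + 4) ^ (-(3 + s)) / c) (by positivity) (Cp + Cf + 1).toReal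
  -- Chosen so that `f < τ` inside the wedge forces the coordinate along the edge below `r / 4`.
  set M := 16 * τ / r ^ 2 with hM
  have hM0 : 0 < M := by positivity
  have hMr : M * (r / 4) ^ 2 = τ := by rw [hM]; field_simp; norm_num
  -- The bound 1 makes squares at most the norm, so `f ≤ 2 * ‖Y - X₀‖ < τ` on the small ball.
  refine ⟨min (min r 1) (τ / 3), by positivity, fun S X₀ Ω E hΩ hcone hEΩ hE => ?_⟩
  set f : EuclideanSpace ℝ (Fin 3) → ℝ := fun Y => S (Y - X₀) 1 + M * S (Y - X₀) 2 ^ 2 with hf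
  have hfc : Continuous f := by fun_prop
  set K : Set (EuclideanSpace ℝ (Fin 3)) := Ω ∩ ball X₀ r ∩ {Y | f Y < τ} with hK
  have hKo : IsOpen K := (hΩ.inter isOpen_ball).inter (isOpen_lt hfc continuous_const)
  have hKb : K ⊆ ball X₀ r := fun Y hY => hY.1.2
  obtain ⟨hfin, hle⟩ := (hE.2 K hKo (isBounded_ball.subset hKb) fun Y hY => hY.1.1).interaction_le
    hE.1 hKo.measurableSet
  have hEK : NullMeasurableSet (E ∩ K) := hE.1.inter hKo.measurableSet.nullMeasurableSet
  have hmem : ∀ y ∈ E, ‖y - X₀‖ < r → f y < τ → y ∈ K := fun y hy hyr hyf =>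
    ⟨⟨hEΩ ⟨hy, by simpa [dist_eq_norm] using hyr⟩, by simpa [dist_eq_norm] using hyr⟩, hyf⟩
  have hzero : volume (E ∩ K) = 0 := by
    refine measure_eq_zero_of_calibration hs0 hEK
      ((measure_mono fun Y hY => hKb hY.2).trans_lt measure_ball_lt_top) hfc.measurable hfin hle
      (η₀ := 2 * τ) (by positivity) ?_
    intro η hη hητ x hx
    have hxr : ‖x - X₀‖ < r := by simpa [dist_eq_norm] using hKb hx.2
    have hxc := hcone x hx.2.1.1 hxr
    have hxf : S (x - X₀) 1 + M * S (x - X₀) 2 ^ 2 < τ := hx.2.2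
    set u := x - X₀ with hu
    have hx2 : 0 ≤ M * S u 2 ^ 2 := by positivity
    have hx0 : 0 ≤ c * |S u 0| := by positivity
    have hx0' : |S u 0| < τ / c := by rw [lt_div_iff₀ hc]; linarith
    have hx2' : |S u 2| < r / 4 := by
      refine abs_lt_of_sq_lt_sq (lt_of_mul_lt_mul_left ?_ hM0.le) (by positivity)
      linarith
    -- Hence the ball of radius `r / 2` about `x` stays in `ball X₀ r`, where the wedge condition is
    -- available.
    have hur : ‖u‖ < r / 2 := by
      rw [← S.norm_map u]
      refine (EuclideanSpace.norm_le_abs_add_abs_add_abs _).trans_lt ?_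
      have h1 : |S u 1| < τ := abs_lt.2 ⟨by linarith, by linarith⟩
      have h2 : (6 / c + 4) * τ = τ / c + τ + (5 * (τ / c) + 3 * τ) := by ring
      have h3 : 0 < τ / c := by positivity
      linarith
    set m := 2 * M * S u 2 with hm
    -- Exact, since `f` is quadratic. The slope `m` varies with `x`, hence the need for estimates
    -- uniform in it.
    have hfy : ∀ y, f y = f x + (S (y - x) 1 + m * S (y - x) 2 + M * S (y - x) 2 ^ 2) := by
      intro y
      have : y - X₀ = u + (y - x) := by rw [hu]; abel
      simp only [hf, this, map_add, PiLp.add_apply, ← hu]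
      ring
    set P := {z : EuclideanSpace ℝ (Fin 3) |
      0 < S z 1 + m * S z 2 + M * S z 2 ^ 2 ∧ ‖z‖ < r / 2} with hP
    set N := {z : EuclideanSpace ℝ (Fin 3) |
      S z 1 + m * S z 2 + M * S z 2 ^ 2 < 0 ∧ ‖z‖ < r / 2} with hN
    set G := {z | S z 0 ∈ Set.Ioo (5 * τ / c) (6 * τ / c) ∧ S z 1 ∈ Set.Ioo (2 * τ) (3 * τ) ∧
      S z 2 ∈ Set.Ioo 0 τ} with hG
    have hnear : ∀ y, ‖y - x‖ < r / 2 → ‖y - X₀‖ < r := fun y hy => by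
      have : y - X₀ = u + (y - x) := by rw [hu]; abel
      rw [this]
      exact (norm_add_le _ _).trans_lt (by linarith)
    have hNm : MeasurableSet N :=
      MeasurableSet.inter (s₁ := {z | S z 1 + m * S z 2 + M * S z 2 ^ 2 < 0})
        (s₂ := {z | ‖z‖ < r / 2}) (measurableSet_lt (by fun_prop) (by fun_prop))
        (measurableSet_lt (by fun_prop) (by fun_prop))
    -- Completing the square, `f` rises over the box by more than `2 * τ - M * S u 2 ^ 2 > τ`.
    have hGN : Disjoint G N := by
      refine Set.disjoint_left.2 fun z hz hz' => ?_
      have h1 := hz'.1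
      have h2 := hz.2.1.1
      have h3 : S z 1 + m * S z 2 + M * S z 2 ^ 2 =
        S z 1 + M * (S u 2 + S z 2) ^ 2 - M * S u 2 ^ 2 := by rw [hm]; ring
      have h4 : 0 ≤ M * (S u 2 + S z 2) ^ 2 := by positivity
      linarith
    -- Sideways the box is beyond `5τ/c - τ/c = 4τ/c`, so the wedge would require height above `4τ`;
    -- but the height is below `τ + 3τ`.
    have hGE : ∀ y, y - x ∈ G → y ∈ Eᶜ := by
      intro y hy hyE
      have hu' : y - X₀ = u + (y - x) := by rw [hu]; abel
      obtain ⟨h0, h1, h2⟩ := hy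
      have hyr : ‖y - X₀‖ < r := by
        refine hnear y ?_
        rw [← S.norm_map]
        refine (EuclideanSpace.norm_le_abs_add_abs_add_abs _).trans_lt ?_
        have e0 : |S (y - x) 0| < 6 * τ / c := abs_lt.2 ⟨by
          have : 0 < 5 * τ / c := by positivity
          have : 0 < 6 * τ / c := by positivity
          linarith [h0.1], h0.2⟩
        have e1 : |S (y - x) 1| < 3 * τ := abs_lt.2 ⟨by linarith [h1.1], h1.2⟩
        have e2 : |S (y - x) 2| < τ := abs_lt.2 ⟨by linarith [h2.1], h2.2⟩
        have : (6 / c + 4) * τ = 6 * τ / c + 3 * τ + τ := by ring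
        linarith
      have hcy := hcone y (hEΩ ⟨hyE, by simpa [dist_eq_norm] using hyr⟩) hyr
      rw [hu'] at hcy
      simp only [map_add, PiLp.add_apply] at hcy
      have h3 : 4 * τ / c < S u 0 + S (y - x) 0 := by
        have e : 5 * τ / c = 4 * τ / c + τ / c := by ring
        linarith [(abs_lt.1 hx0').1, h0.1]
      have h4 : 4 * τ < c * |S u 0 + S (y - x) 0| := by
        rw [mul_comm c, ← div_lt_iff₀ hc]
        exact h3.trans_le (le_abs_self _)
      linarith [h1.2]
    -- Near `x`, a point of `E` outside `K` has `f ≥ τ > f x`, so it too lies on the upper side;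
    -- `Cf` absorbs the far points.
    have hupper : (∫⁻ y in E \ K, truncKernel s η (y - x)) +
        (∫⁻ y in E ∩ K ∩ {y | f x < f y}, truncKernel s η (y - x)) ≤
        (∫⁻ z in P, truncKernel s η z) + Cf := by
      rw [← lintegral_add_measure, ← Measure.restrict_union₀
        (Set.disjoint_left.2 fun y hy hy' => hy.2 hy'.1.2).aedisjoint
        (hEK.inter (measurableSet_lt measurable_const hfc.measurable).nullMeasurableSet)]
      calc _ ≤ ∫⁻ y in {y | y - x ∈ P ∪ (ball 0 (r / 2))ᶜ}, truncKernel s η (y - x) := by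
            refine lintegral_mono_set fun y hy => ?_
            rcases lt_or_ge ‖y - x‖ (r / 2) with hyx | hyx
            · left
              refine ⟨?_, hyx⟩
              have : f x < f y := by
                rcases hy with hy | hy
                · refine hx.2.2.trans_le (not_lt.1 fun h => hy.2 (hmem y hy.1 (hnear y hyx) h))
                · exact hy.2
              rw [hfy y] at this
              linarith
            · right
              simpa using hyx
        _ = ∫⁻ z in P ∪ (ball 0 (r / 2))ᶜ, truncKernel s η z :=
            setLIntegral_sub_right x _ _
        _ ≤ _ := lintegral_union_le _ _ _
        _ ≤ _ := by
            gcongr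
            exact lintegral_mono fun z => truncKernel_le η z
    -- Near `x`, a point with `f y < f x` is in `Eᶜ` or in the cut; the box adds its mass to `Eᶜ`.
    have hlower : (∫⁻ z in G, truncKernel s η z) + (∫⁻ z in N, truncKernel s η z) ≤
        (∫⁻ y in Eᶜ, truncKernel s η (y - x)) +
          ∫⁻ y in E ∩ K ∩ {y | f y < f x}, truncKernel s η (y - x) := by
      rw [← lintegral_union hNm hGN, ← setLIntegral_sub_right x]
      refine le_trans (lintegral_mono_set fun y hy => ?_) (lintegral_union_le _ _ _)
      rcases hy with hy | hy
      · exact Or.inl (hGE y hy)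
      · by_cases hyE : y ∈ E
        · right
          have : f y < f x := by
            rw [hfy y]; linarith [hy.1]
          exact ⟨⟨hyE, hmem y hyE (hnear y hy.2) (this.trans hx.2.2)⟩, this⟩
        · exact Or.inl hyE
    have hG' : Cp + Cf + 1 ≤ ∫⁻ z in G, truncKernel s η z := by
      refine le_trans ?_ (le_lintegral_box_truncKernel hs0 hc hτ hητ S)
      rw [← ENNReal.ofReal_toReal (a := Cp + Cf + 1)
        (ENNReal.add_lt_top.2 ⟨ENNReal.add_lt_top.2 ⟨hCp, hfar⟩, ENNReal.one_lt_top⟩).ne]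
      exact ENNReal.ofReal_le_ofReal hgain
    calc _ ≤ (∫⁻ z in P, truncKernel s η z) + Cf + 1 := by gcongr
      _ ≤ (∫⁻ z in N, truncKernel s η z) + Cp + Cf + 1 := by
          gcongr
          exact hpar S η m M hM0.le hM1
      _ = (Cp + Cf + 1) + ∫⁻ z in N, truncKernel s η z := by ring
      _ ≤ (∫⁻ z in G, truncKernel s η z) + ∫⁻ z in N, truncKernel s η z := by gcongr
      _ ≤ _ := hlower
  refine measure_mono_null ?_ hzero
  intro Y hY
  have hYδ : ‖Y - X₀‖ < min (min r 1) (τ / 3) := by simpa [dist_eq_norm] using hY.2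
  obtain ⟨hY1, hY2⟩ := lt_min_iff.1 hYδ
  obtain ⟨hYr, hY1⟩ := lt_min_iff.1 hY1
  refine ⟨hY.1, hmem Y hY.1 hYr ?_⟩
  have h1 : S (Y - X₀) 1 ≤ ‖Y - X₀‖ := by
    rw [← S.norm_map]
    exact (le_abs_self _).trans (PiLp.norm_apply_le (S (Y - X₀)) 1)
  have h2 : |S (Y - X₀) 2| ≤ ‖Y - X₀‖ := by
    rw [← S.norm_map]
    exact PiLp.norm_apply_le (S (Y - X₀)) 2
  have h3 : S (Y - X₀) 2 ^ 2 ≤ ‖Y - X₀‖ := by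
    rw [← sq_abs]
    nlinarith [abs_nonneg (S (Y - X₀) 2)]
  have h4 : M * S (Y - X₀) 2 ^ 2 ≤ S (Y - X₀) 2 ^ 2 :=
    mul_le_of_le_one_left (sq_nonneg _) hM1
  simp only [hf]
  linarith

/-! ### Geometry of the axis and the vertical cylinder. -/

lemma norm_sq_eq_horizontal (X : EuclideanSpace ℝ (Fin 3)) :
    ‖X‖ ^ 2 = ‖horizontal X‖ ^ 2 + X 2 ^ 2 := by
  simp [EuclideanSpace.norm_sq_eq, Fin.sum_univ_three, horizontal]

lemma norm_horizontal_le (X : EuclideanSpace ℝ (Fin 3)) : ‖horizontal X‖ ≤ ‖X‖ :=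
  le_of_sq_le_sq (by nlinarith [norm_sq_eq_horizontal X]) (norm_nonneg _)

@[fun_prop]
lemma continuous_horizontal : Continuous horizontal := by
  unfold horizontal
  fun_prop

/-- The point at height `h` on the vertical axis. -/
noncomputable def axisPoint (h : ℝ) : EuclideanSpace ℝ (Fin 3) := !₂[0, 0, h]

lemma horizontal_sub_axisPoint (X : EuclideanSpace ℝ (Fin 3)) (h : ℝ) :
    horizontal (X - axisPoint h) = horizontal X := by
  simp [horizontal, axisPoint]

lemma norm_sub_axisPoint_self (X : EuclideanSpace ℝ (Fin 3)) :
    ‖X - axisPoint (X 2)‖ = ‖horizontal X‖ := by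
  have := norm_sq_eq_horizontal (X - axisPoint (X 2))
  rw [horizontal_sub_axisPoint] at this
  have h2 : (X - axisPoint (X 2)) 2 = 0 := by simp [axisPoint]
  rw [h2] at this
  exact (sq_eq_sq₀ (norm_nonneg _) (norm_nonneg _)).1 (by linarith)

lemma abs_sub_lt_of_mem_ball_axisPoint {X : EuclideanSpace ℝ (Fin 3)} {h r : ℝ}
    (hX : X ∈ ball (axisPoint h) r) : |X 2 - h| < r := by
  rw [mem_ball, dist_eq_norm] at hX
  refine lt_of_le_of_lt ?_ hX
  simpa [axisPoint] using PiLp.norm_apply_le (X - axisPoint h) 2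

lemma norm_horizontal_lt_of_mem_ball_axisPoint {X : EuclideanSpace ℝ (Fin 3)} {h r : ℝ}
    (hX : X ∈ ball (axisPoint h) r) : ‖horizontal X‖ < r := by
  rw [mem_ball, dist_eq_norm] at hX
  rw [← horizontal_sub_axisPoint X h]
  exact (norm_horizontal_le _).trans_lt hX

/-- Every isometry of the plane extends to an isometry of space fixing the vertical coordinate. -/
lemma exists_linearIsometryEquiv_horizontal
    (T : EuclideanSpace ℝ (Fin 2) ≃ₗᵢ[ℝ] EuclideanSpace ℝ (Fin 2)) :
    ∃ S : EuclideanSpace ℝ (Fin 3) ≃ₗᵢ[ℝ] EuclideanSpace ℝ (Fin 3),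
      ∀ X, horizontal (S X) = T (horizontal X) := by
  let S₀ : EuclideanSpace ℝ (Fin 3) →ₗ[ℝ] EuclideanSpace ℝ (Fin 3) :=
    { toFun := fun X => !₂[T (horizontal X) 0, T (horizontal X) 1, X 2]
      map_add' := fun X Y => by
        have : horizontal (X + Y) = horizontal X + horizontal Y := by
          ext i; fin_cases i <;> simp [horizontal]
        ext i; fin_cases i <;> simp [this]
      map_smul' := fun a X => by
        have : horizontal (a • X) = a • horizontal X := by
          ext i; fin_cases i <;> simp [horizontal]
        ext i; fin_cases i <;> simp [this] }
  have hS : ∀ X, horizontal (S₀ X) = T (horizontal X) := fun X => by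
    ext i; fin_cases i <;> simp [horizontal, S₀]
  have hS2 : ∀ X, S₀ X 2 = X 2 := fun X => by simp [S₀]
  have hnorm : ∀ X, ‖S₀ X‖ = ‖X‖ := fun X => by
    refine (sq_eq_sq₀ (norm_nonneg _) (norm_nonneg _)).1 ?_
    rw [norm_sq_eq_horizontal, norm_sq_eq_horizontal X, hS, hS2, T.norm_map]
  exact ⟨LinearIsometry.toLinearIsometryEquiv ⟨S₀, hnorm⟩ rfl, hS⟩

lemma isOpen_verticalCylinder {ω : Set (EuclideanSpace ℝ (Fin 2))} (hω : IsOpen ω) :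
    IsOpen (verticalCylinder ω) :=
  hω.preimage continuous_horizontal

/-- Near the vertical edge of a cylinder over a convex corner, an `s`-minimal set which locally
does not meet the complement of the cylinder has measure zero. -/
lemma HasConvexCornerAtZero.exists_measure_inter_ball_eq_zero {s : ℝ} (hs0 : 0 < s) (hs1 : s < 1)
    {ω : Set (EuclideanSpace ℝ (Fin 2))} (hω : IsOpen ω) (hcorner : HasConvexCornerAtZero ω) :
    ∃ ρ : ℝ, 0 < ρ ∧ ∀ r : ℝ, 0 < r → r ≤ ρ → ∃ δ : ℝ, 0 < δ ∧
      ∀ (E : Set (EuclideanSpace ℝ (Fin 3))) (h : ℝ), IsSMinimal s E (verticalCylinder ω) →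
        E ∩ ball (axisPoint h) r ⊆ verticalCylinder ω →
        volume (E ∩ ball (axisPoint h) δ) = 0 := by
  obtain ⟨T, ρ, c, φ, hρ, hc, -, hφ, hT⟩ := hcorner
  refine ⟨ρ, hρ, fun r hr hrρ => ?_⟩
  obtain ⟨δ, hδ, H⟩ := IsSMinimal.exists_measure_inter_ball_eq_zero hs0 hs1 hr hc
  obtain ⟨S, hS⟩ := exists_linearIsometryEquiv_horizontal T.symm
  refine ⟨δ, hδ, fun E h hE hEΩ => H S _ _ E (isOpen_verticalCylinder hω) ?_ hEΩ hE⟩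
  intro X hX hXr
  have hSX : horizontal (S (X - axisPoint h)) = T.symm (horizontal X) := by
    rw [hS, horizontal_sub_axisPoint]
  set x := T.symm (horizontal X) with hx
  have h0 : S (X - axisPoint h) 0 = x 0 := by rw [← hSX]; simp [horizontal]
  have h1 : S (X - axisPoint h) 1 = x 1 := by rw [← hSX]; simp [horizontal]
  have hxρ : ‖x‖ < ρ := by
    rw [← hSX]
    refine (norm_horizontal_le _).trans_lt ?_
    rw [S.norm_map]
    exact hXr.trans_le hrρ
  rw [h0, h1]
  exact (hφ _ ((PiLp.norm_apply_le x 0).trans_lt hxρ)).trans_lt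
    ((hT x hxρ).1 (by rw [hx, T.apply_symm_apply]; exact hX))

/-- If `F` has measure zero near the points of the axis at heights in `J`, then it has measure zero
in the corresponding part of a cylinder around the axis. -/
lemma measure_inter_cylinder_eq_zero {F : Set (EuclideanSpace ℝ (Fin 3))} {J : Set ℝ} {δ : ℝ}
    (hF : ∀ h ∈ J, volume (F ∩ ball (axisPoint h) δ) = 0) :
    volume (F ∩ verticalCylinder (ball 0 δ) ∩ {X | X 2 ∈ J}) = 0 := by
  -- Each point is compared with the axis point at its own height, whose distance is the horizontal
  -- norm.
  refine measure_null_of_locally_null _ fun X hX => ⟨F ∩ ball (axisPoint (X 2)) δ, ?_, hF _ hX.2⟩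
  have hball : X ∈ ball (axisPoint (X 2)) δ := by
    rw [mem_ball, dist_eq_norm, norm_sub_axisPoint_self]
    simpa [verticalCylinder] using hX.1.2
  exact Filter.inter_mem (Filter.mem_of_superset self_mem_nhdsWithin fun Y hY => hY.1.1)
    (mem_nhdsWithin_of_mem_nhds (isOpen_ball.mem_nhds hball))

lemma exists_measure_inter_ball_eq_zero_of_isOpen {F V : Set (EuclideanSpace ℝ (Fin 3))}
    (hV : IsOpen V) (hFV : volume (F ∩ V) = 0) {X : EuclideanSpace ℝ (Fin 3)} (hX : X ∈ V) :
    ∃ r > 0, volume (F ∩ ball X r) = 0 := by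
  obtain ⟨r, hr, hrV⟩ := Metric.isOpen_iff.1 hV X hX
  exact ⟨r, hr, measure_mono_null (Set.inter_subset_inter_right _ hrV) hFV⟩

/-! ### Continuity at the edge. -/

theorem corollary1p4 (s : ℝ) (hs0 : 0 < s) (hs1 : s < 1)
    (ω : Set (EuclideanSpace ℝ (Fin 2))) (hω : IsOpen ω) (hωb : Bornology.IsBounded ω)
    (hcorner : HasConvexCornerAtZero ω)
    (ψ : EuclideanSpace ℝ (Fin 2) → ℝ) (hψ : ContDiff ℝ ((⊤ : ℕ∞) : WithTop ℕ∞) ψ)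
    (hψ0 : ∀ᶠ x in 𝓝 (0 : EuclideanSpace ℝ (Fin 2)), ψ x = 0)
    (E : Set (EuclideanSpace ℝ (Fin 3))) (hE : IsSMinimal s E (verticalCylinder ω))
    (hE0 : E \ verticalCylinder ω = subgraph ψ \ verticalCylinder ω) :
    ∀ ε : ℝ, 0 < ε → ∃ δ : ℝ, 0 < δ ∧
      volume ((E ∩ verticalCylinder (ball 0 δ)) \ {X | X 2 ≤ ε}) = 0 ∧
      volume ((Eᶜ ∩ verticalCylinder (ball 0 δ)) \ {X | -ε ≤ X 2}) = 0 ∧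
      (IsNormalizedIn E (verticalCylinder ω) →
        E ∩ verticalCylinder (ball 0 δ) ⊆ {X | X 2 ≤ ε} ∧
        Eᶜ ∩ verticalCylinder (ball 0 δ) ⊆ {X | -ε ≤ X 2} ∧
        frontier E ∩ verticalCylinder (ball 0 δ) ⊆ {X | |X 2| ≤ ε}) := by
  intro ε hε
  obtain ⟨ρ, hρ, H⟩ := hcorner.exists_measure_inter_ball_eq_zero hs0 hs1 hω
  obtain ⟨ρ', hρ', hψρ⟩ := Metric.eventually_nhds_iff_ball.1 hψ0
  have hout : ∀ X, ‖horizontal X‖ < ρ' → X ∉ verticalCylinder ω → (X ∈ E ↔ X 2 < 0) := by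
    intro X hX hXω
    have h1 := Set.ext_iff.1 hE0 X
    have h2 : ψ (horizontal X) = 0 := hψρ _ (by simpa using hX)
    have h3 : X ∈ subgraph ψ ↔ X 2 < ψ (horizontal X) := Iff.rfl
    rw [h2] at h3
    rw [← h3]
    simpa [hXω] using h1
  -- The radius is at most `ρ` for the corner, `ρ'` for `ψ = 0`, and `ε` so that balls centred
  -- beyond height `±ε` do not reach height 0.
  obtain ⟨δ₀, hδ₀, H⟩ := H (min ρ (min ρ' ε)) (by positivity) (min_le_left _ _)
  have hrρ' : min ρ (min ρ' ε) ≤ ρ' := (min_le_right _ _).trans (min_le_left _ _)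
  have hrε : min ρ (min ρ' ε) ≤ ε := (min_le_right _ _).trans (min_le_right _ _)
  have hδle : min δ₀ ρ' ≤ δ₀ := min_le_left _ _
  set δ := min δ₀ ρ'
  have hC : ∀ X, X ∈ verticalCylinder (ball 0 δ) ↔ ‖horizontal X‖ < δ := fun X => by
    simp [verticalCylinder]
  have hCo : IsOpen (verticalCylinder (ball 0 δ)) := isOpen_verticalCylinder isOpen_ball
  have hup : volume (E ∩ (verticalCylinder (ball 0 δ) ∩ {X | X 2 ∈ Set.Ioi ε})) = 0 := by
    rw [← Set.inter_assoc]
    refine measure_inter_cylinder_eq_zero fun h hh => ?_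
    refine measure_mono_null (Set.inter_subset_inter_right _ (ball_subset_ball hδle))
      (H E h hE fun X hX => ?_)
    by_contra hXω
    have h1 := (hout X ((norm_horizontal_lt_of_mem_ball_axisPoint hX.2).trans_le hrρ') hXω).1 hX.1
    have h2 := (abs_lt.1 (abs_sub_lt_of_mem_ball_axisPoint hX.2)).1
    have h3 : ε < h := hh
    linarith
  have hdown : volume (Eᶜ ∩ (verticalCylinder (ball 0 δ) ∩ {X | X 2 ∈ Set.Iio (-ε)})) = 0 := by
    rw [← Set.inter_assoc]
    refine measure_inter_cylinder_eq_zero fun h hh => ?_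
    refine measure_mono_null (Set.inter_subset_inter_right _ (ball_subset_ball hδle))
      (H Eᶜ h hE.compl fun X hX => ?_)
    by_contra hXω
    refine hX.1 ((hout X ((norm_horizontal_lt_of_mem_ball_axisPoint hX.2).trans_le hrρ') hXω).2 ?_)
    have h2 := (abs_lt.1 (abs_sub_lt_of_mem_ball_axisPoint hX.2)).2
    have h3 : h < -ε := hh
    linarith
  have hupo : IsOpen (verticalCylinder (ball 0 δ) ∩ {X | X 2 ∈ Set.Ioi ε}) :=
    hCo.inter (isOpen_Ioi.preimage (f := fun X : EuclideanSpace ℝ (Fin 3) => X 2) (by fun_prop))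
  have hdowno : IsOpen (verticalCylinder (ball 0 δ) ∩ {X | X 2 ∈ Set.Iio (-ε)}) :=
    hCo.inter (isOpen_Iio.preimage (f := fun X : EuclideanSpace ℝ (Fin 3) => X 2) (by fun_prop))
  refine ⟨δ, by positivity, ?_, ?_, fun hnorm => ?_⟩
  · refine measure_mono_null ?_ hup
    exact fun X hX => ⟨hX.1.1, hX.1.2, (lt_of_not_ge fun h => hX.2 h : ε < X 2)⟩
  · refine measure_mono_null ?_ hdown
    exact fun X hX => ⟨hX.1.1, hX.1.2, (lt_of_not_ge fun h => hX.2 h : X 2 < -ε)⟩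
  -- Normalization acts only inside the cylinder; outside it the exterior datum decides, which needs
  -- `δ ≤ ρ'`.
  have hE1 : ∀ X ∈ verticalCylinder (ball 0 δ), ε < X 2 → X ∉ E := by
    intro X hX hXε hXE
    by_cases hXω : X ∈ verticalCylinder ω
    · exact (hnorm X hXω).1
        (exists_measure_inter_ball_eq_zero_of_isOpen hupo hup ⟨hX, hXε⟩) hXE
    · have := (hout X (((hC X).1 hX).trans_le (min_le_right _ _)) hXω).1 hXE
      linarith
  have hE2 : ∀ X ∈ verticalCylinder (ball 0 δ), X 2 < -ε → X ∈ E := by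
    intro X hX hXε
    by_cases hXω : X ∈ verticalCylinder ω
    · exact (hnorm X hXω).2
        (exists_measure_inter_ball_eq_zero_of_isOpen hdowno hdown ⟨hX, hXε⟩)
    · exact (hout X (((hC X).1 hX).trans_le (min_le_right _ _)) hXω).2 (by linarith)
  refine ⟨fun X hX => not_lt.1 fun h => hE1 X hX.2 h hX.1,
    fun X hX => not_lt.1 fun h => hX.1 (hE2 X hX.2 h), fun X hX => ?_⟩
  -- Both outer regions are open and lie entirely in `E` or entirely off `E`, so neither meets the
  -- frontier.
  rw [Set.mem_ofPred_eq, abs_le]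
  constructor
  · refine not_lt.1 fun h => hX.1.2 ?_
    exact mem_interior.2 ⟨_, fun Y hY => hE2 Y hY.1 hY.2, hdowno, hX.2, h⟩
  · refine not_lt.1 fun h => ?_
    obtain ⟨Y, hY, hYE⟩ := mem_closure_iff.1 hX.1.1 _ hupo ⟨hX.2, h⟩
    exact hE1 Y hY.1 hY.2 hYE
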